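/- Let $\mathbf M$ be a finite algebra (algebras are non-empty) in an algebraic language, and let $\mathbb{ISP}(\mathcal K)$ denote the class of isomorphic copies of subalgebras of products (the empty product included) of members of a class $\mathcal K$ of algebras of that language. Let $\underset{\sim}{\mathbf M}=(M;G,H,R,\mathcal T)$ be an alter ego of $\mathbf M$: $\mathcal T$ is the discrete topology, $G$ is a set of homomorphisms $\mathbf M^n\to\mathbf M$ ($n\ge 0$), $H$ is a set of homomorphisms from subalgebras of $\mathbf M^n$ into $\mathbf M$ ($n\ge 1$), regarded as partial operations, and $R$ is a set of universes of subalgebras of $\mathbf M^n$ ($n\ge1$). Substructures are subsets closed under $G$ and, where defined, under $H$, with the induced structure; they may be empty. Morphisms are continuous maps that preserve $G$, $H$ (together with the domains of the partial operations) and $R$. Let $\mathcal X$ be the category of isomorphic copies of closed substructures of non-empty powers of $\underset{\sim}{\mathbf M}$, with these morphisms. An embedding in $\mathcal X$ is a morphism that is an isomorphism onto a substructure of its codomain. For $\mathbf A\in\mathbb{ISP}(\mathbf M)$ let $D(\mathbf A)$ be the set of homomorphisms $\mathbf A\to\mathbf M$, as a substructure of $\underset{\sim}{\mathbf M}^{A}$;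 for $\mathbf X\in\mathcal X$ let $E(\mathbf X)$ be the algebra of morphisms $\mathbf X\to\underset{\sim}{\mathbf M}$ with the pointwise operations of $\mathbf M$. Assume that $\underset{\sim}{\mathbf M}$ yields a strong duality on $\mathbb{ISP}(\mathbf M)$: for every $\mathbf A\in\mathbb{ISP}(\mathbf M)$ the evaluation map $\mathbf A\to E(D(\mathbf A))$, $a\mapsto(x\mapsto x(a))$, is surjective, and $\underset{\sim}{\mathbf M}$ is injective in $\mathcal X$ with respect to embeddings. For a finite $\mathbf X\in\mathcal X$, an $\mathbf X$-substructure of $\mathbf X$ is a substructure of the form $\langle \mathrm{im}\,\varphi_1\cup\dots\cup \mathrm{im}\,\varphi_m\rangle$ with $m\ge 0$ and morphisms $\varphi_1,\dots,\varphi_m:\mathbf X\to\mathbf X$, where $\langle S\rangle$ denotes the substructure generated by $S$. Ordered by inclusion these form a lattice $\mathcal S_{\mathbf X}$, in which the join of two elements is the substructure generated by their union. An element of $\mathcal S_{\mathbf X}$ is join-irreducible if it is not the least element and is not the join of two elements different from it; it is maximal join-irreducible if it is maximal, with respect to inclusion, among the join-irreducible elements. Let $\mathbf B\in\mathbb{ISP}(\mathbf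 M)$ be finite and let $\mathcal Q=\mathbb{ISP}(\mathbf B)$. Then \[ \mathcal Q=\mathbb{ISP}\bigl(\{E(\mathbf Y)\mid \mathbf Y\text{ is maximal join-irreducible in }\mathcal S_{D(\mathbf B)}\}\bigr). \] -/

import Mathlib

universe u v w z

namespace NaturalDuality

open FirstOrder

/-! ### Algebras and the class operators -/

/-- An algebra for the language `L` (which will be assumed to have no relation symbols). -/
structure Alg (L : FirstOrder.Language.{v, w}) where
  carrier : Type u
  [str : L.Structure carrier]

instance instCoeSortAlg {L : FirstOrder.Language.{v, w}} : CoeSort (Alg.{u} L) (Type u) := ⟨Alg.carrier⟩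

instance instStructureAlg {L : FirstOrder.Language.{v, w}} (A : Alg.{u} L) : L.Structure A := A.str

/-- The coordinatewise structure on a product. -/
instance instStructurePi {L : FirstOrder.Language.{v, w}} {ι : Type z} (A : ι → Type u)
    [∀ i, L.Structure (A i)] : L.Structure (∀ i, A i) where
  funMap f x := fun i => FirstOrder.Language.Structure.funMap f (fun j => x j i)
  RelMap r x := ∀ i, FirstOrder.Language.Structure.RelMap r (fun j => x j i)

/-- Isomorphic copies of members of `K`. -/
def opI {L : FirstOrder.Language.{v, w}} (K : Set (Alg.{u} L)) : Set (Alg.{u} L) :=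
  {A | ∃ B ∈ K, Nonempty (A ≃[L] B)}

/-- Subalgebras of members of `K`. As usual, a subalgebra is non-empty. -/
def opS {L : FirstOrder.Language.{v, w}} (K : Set (Alg.{u} L)) : Set (Alg.{u} L) :=
  {A | ∃ B ∈ K, ∃ T : L.Substructure B, (T : Set B).Nonempty ∧ A = Alg.mk T}

/-- Products of families of members of `K`. The empty family is allowed, and its product is the
one-element algebra. -/
def opP {L : FirstOrder.Language.{v, w}} (K : Set (Alg.{u} L)) : Set (Alg.{u} L) :=
  {A | ∃ (ι : Type u) (F : ι → Alg.{u} L), (∀ i, F i ∈ K) ∧ A = Alg.mk (∀ i, F i)}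

/-- The class `ISP(K)`. -/
def ISP {L : FirstOrder.Language.{v, w}} (K : Set (Alg.{u} L)) : Set (Alg.{u} L) := opI (opS (opP K))

/-! ### Topological structures with operations, partial operations and relations -/

/-- The type of a structured space: symbols for total operations (of arity `≥ 0`), for partial
operations (of arity `≥ 1`) and for relations (of arity `≥ 1`). -/
structure Sig where
  Op : Type z
  opArity : Op → ℕ
  POp : Type z
  popArity : POp → ℕ
  popArity_pos : ∀ h, 1 ≤ popArity h
  Rel : Type z
  relArity : Rel → ℕ
  relArity_pos : ∀ r, 1 ≤ relArity r

/-- A topological structure of type `τ`. -/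
structure TopStr (τ : Sig.{z}) where
  carrier : Type u
  [top : TopologicalSpace carrier]
  op : ∀ g : τ.Op, (Fin (τ.opArity g) → carrier) → carrier
  dom : ∀ h : τ.POp, Set (Fin (τ.popArity h) → carrier)
  pop : ∀ h : τ.POp, dom h → carrier
  rel : ∀ r : τ.Rel, Set (Fin (τ.relArity r) → carrier)

instance instCoeSortTopStr {τ : Sig.{z}} : CoeSort (TopStr.{u} τ) (Type u) := ⟨TopStr.carrier⟩

instance instTopologicalSpaceTopStr {τ : Sig.{z}} (X : TopStr.{u} τ) : TopologicalSpace X := X.top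

namespace TopStr

/-- Continuous structure-preserving maps. -/
@[ext]
structure Hom {τ : Sig.{z}} (X Y : TopStr.{u} τ) where
  toFun : X → Y
  continuous_toFun : Continuous toFun
  map_op : ∀ (g : τ.Op) (x : Fin (τ.opArity g) → X), toFun (X.op g x) = Y.op g (toFun ∘ x)
  map_dom : ∀ (h : τ.POp) (x : Fin (τ.popArity h) → X), x ∈ X.dom h → toFun ∘ x ∈ Y.dom h
  map_pop : ∀ (h : τ.POp) (x : Fin (τ.popArity h) → X) (hx : x ∈ X.dom h),
    toFun (X.pop h ⟨x, hx⟩) = Y.pop h ⟨toFun ∘ x, map_dom h x hx⟩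
  map_rel : ∀ (r : τ.Rel) (x : Fin (τ.relArity r) → X), x ∈ X.rel r → toFun ∘ x ∈ Y.rel r

instance instFunLikeHom {τ : Sig.{z}} (X Y : TopStr.{u} τ) : FunLike (Hom X Y) X Y where
  coe := Hom.toFun
  coe_injective _ _ h := Hom.ext h

/-- Isomorphisms: morphisms with a two-sided inverse morphism. -/
structure Iso {τ : Sig.{z}} (X Y : TopStr.{u} τ) where
  hom : Hom X Y
  inv : Hom Y X
  hom_inv : ∀ x, inv (hom x) = x
  inv_hom : ∀ y, hom (inv y) = y

/-- (The universe of) a substructure: a subset that is closed under the total operations, and under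
the partial operations wherever they are defined. It may be empty. -/
structure Sub {τ : Sig.{z}} (X : TopStr.{u} τ) where
  carrier : Set X
  op_mem : ∀ (g : τ.Op) (x : Fin (τ.opArity g) → X), (∀ i, x i ∈ carrier) → X.op g x ∈ carrier
  pop_mem : ∀ (h : τ.POp) (x : Fin (τ.popArity h) → X) (hx : x ∈ X.dom h),
    (∀ i, x i ∈ carrier) → X.pop h ⟨x, hx⟩ ∈ carrier

instance instSetLikeSub {τ : Sig.{z}} (X : TopStr.{u} τ) : SetLike (Sub X) X where
  coe := Sub.carrier
  coe_injective Y Z h := by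
    cases Y
    cases Z
    congr

/-- Substructures are ordered by inclusion. -/
instance instPartialOrderSub {τ : Sig.{z}} (X : TopStr.{u} τ) : PartialOrder (Sub X) :=
  .ofSetLike (Sub X) X

/-- A substructure as a structure of its own: operations, partial operations and relations are
restricted, and the topology is the subspace topology. -/
def Sub.toTopStr {τ : Sig.{z}} {X : TopStr.{u} τ} (Y : Sub X) : TopStr.{u} τ where
  carrier := {x : X // x ∈ Y}
  op g x := ⟨X.op g (fun i => (x i).1), Y.op_mem g _ fun i => (x i).2⟩
  dom h := {x | (fun i => (x i).1) ∈ X.dom h}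
  pop h x := ⟨X.pop h ⟨fun i => (x.1 i).1, x.2⟩, Y.pop_mem h _ x.2 fun i => (x.1 i).2⟩
  rel r := {x | (fun i => (x i).1) ∈ X.rel r}

/-- The power `X ^ S`, with the product topology and everything lifted pointwise. -/
def power {τ : Sig.{z}} (X : TopStr.{u} τ) (S : Type u) : TopStr.{u} τ where
  carrier := S → X
  op g x := fun s => X.op g (fun i => x i s)
  dom h := {x | ∀ s, (fun i => x i s) ∈ X.dom h}
  pop h x := fun s => X.pop h ⟨fun i => x.1 i s, x.2 s⟩
  rel r := {x | ∀ s, (fun i => x i s) ∈ X.rel r}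

/-- Embeddings: morphisms `φ : X → Y` whose image is a substructure `Z` of `Y` and which are
isomorphisms from `X` onto `Z`. -/
def IsEmbedding {τ : Sig.{z}} {X Y : TopStr.{u} τ} (φ : Hom X Y) : Prop :=
  ∃ (Z : Sub Y) (ψ : Iso X Z.toTopStr), ∀ x, φ x = (ψ.hom x).1

/-- Isomorphic copies of (topologically) closed substructures of non-empty powers of `X`. The empty
structure is a substructure, unless there are nullary operations. -/
def IScP {τ : Sig.{z}} (X : TopStr.{u} τ) : Set (TopStr.{u} τ) :=
  {Y | ∃ S : Type u, Nonempty S ∧ ∃ Z : Sub (X.power S),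
    IsClosed (Z : Set (X.power S)) ∧ Nonempty (Iso Y Z.toTopStr)}

/-- The substructure `⟨s⟩` generated by a subset `s`. -/
def closure {τ : Sig.{z}} {X : TopStr.{u} τ} (s : Set X) : Sub X where
  carrier := {x | ∀ Z : Sub X, s ⊆ Z → x ∈ Z}
  op_mem g x hx Z hZ := Z.op_mem g x fun i => hx i Z hZ
  pop_mem h x hd hx Z hZ := Z.pop_mem h x hd fun i => hx i Z hZ

theorem subset_closure {τ : Sig.{z}} {X : TopStr.{u} τ} (s : Set X) :
    s ⊆ (closure s : Set X) :=
  fun _ hx _ hZ => hZ hx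

theorem closure_le {τ : Sig.{z}} {X : TopStr.{u} τ} {s : Set X} {Z : Sub X} (h : s ⊆ Z) :
    closure s ≤ Z :=
  fun _ hx => hx Z h

/-- `Z` is a `Y`-substructure of `X`: it is generated by the union of the images of finitely many
(possibly no) morphisms `Y → X`. -/
def IsYSub {τ : Sig.{z}} (Y : TopStr.{u} τ) {X : TopStr.{u} τ} (Z : Sub X) : Prop :=
  ∃ (m : ℕ) (φ : Fin m → Hom Y X), Z = closure (⋃ i, Set.range (φ i))

/-- The ordered set of `X`-substructures of `X`, ordered by inclusion. -/
def SLat {τ : Sig.{z}} (X : TopStr.{u} τ) : Type u := {Z : Sub X // IsYSub X Z}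

instance instPartialOrderSLat {τ : Sig.{z}} (X : TopStr.{u} τ) : PartialOrder (SLat X) :=
  inferInstanceAs (PartialOrder {Z : Sub X // IsYSub X Z})

theorem IsYSub.sup {τ : Sig.{z}} {Y X : TopStr.{u} τ} {Z W : Sub X}
    (hZ : IsYSub Y Z) (hW : IsYSub Y W) : IsYSub Y (closure ((Z : Set X) ∪ W)) := by
  obtain ⟨m, φ, rfl⟩ := hZ
  obtain ⟨n, ψ, rfl⟩ := hW
  refine ⟨m + n, Fin.append φ ψ, le_antisymm (closure_le (Set.union_subset ?_ ?_))
    (closure_le (Set.iUnion_subset fun i => ?_))⟩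
  · refine closure_le (Set.iUnion_subset fun i => ?_)
    refine subset_trans ?_ (subset_closure _)
    refine subset_trans ?_ (Set.subset_iUnion _ (Fin.castAdd n i))
    rw [Fin.append_left]
  · refine closure_le (Set.iUnion_subset fun i => ?_)
    refine subset_trans ?_ (subset_closure _)
    refine subset_trans ?_ (Set.subset_iUnion _ (Fin.natAdd m i))
    rw [Fin.append_right]
  · refine subset_trans ?_ (subset_closure _)
    refine Fin.addCases (fun i => ?_) (fun i => ?_) i
    · rw [Fin.append_left]
      exact subset_trans
        (subset_trans (Set.subset_iUnion (fun i => Set.range (φ i)) i) (subset_closure _))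
        Set.subset_union_left
    · rw [Fin.append_right]
      exact subset_trans
        (subset_trans (Set.subset_iUnion (fun i => Set.range (ψ i)) i) (subset_closure _))
        Set.subset_union_right

/-- The join of two `X`-substructures is the substructure generated by their union. (For finite `X`,
this makes the `X`-substructures a finite join-semilattice with least element, hence a lattice.) -/
instance instSemilatticeSupSLat {τ : Sig.{z}} (X : TopStr.{u} τ) : SemilatticeSup (SLat X) where
  sup Z W := ⟨closure ((Z.1 : Set X) ∪ W.1), Z.2.sup W.2⟩
  le_sup_left _ _ := Set.Subset.trans Set.subset_union_left (subset_closure _)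
  le_sup_right _ _ := Set.Subset.trans Set.subset_union_right (subset_closure _)
  sup_le _ _ _ h₁ h₂ := closure_le (Set.union_subset h₁ h₂)

end TopStr

/-! ### Alter egos and natural dualities -/

/-- An alter ego of the algebra `M`: a set of homomorphisms `M ^ n → M`, a set of homomorphisms into
`M` from subalgebras of `M ^ n`, and a set of subalgebras of `M ^ n`. -/
structure AlterEgo {L : FirstOrder.Language.{v, w}} (M : Alg.{u} L) where
  sig : Sig.{z}
  op : ∀ g : sig.Op, (Fin (sig.opArity g) → M) →[L] M
  dom : ∀ h : sig.POp, L.Substructure (Fin (sig.popArity h) → M)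
  pop : ∀ h : sig.POp, dom h →[L] M
  rel : ∀ r : sig.Rel, L.Substructure (Fin (sig.relArity r) → M)

namespace AlterEgo

/-- The alter ego as a topological structure on the set `M`, with the discrete topology. -/
def toTopStr {L : FirstOrder.Language.{v, w}} {M : Alg.{u} L} (N : AlterEgo.{u, v, w, z} M) :
    TopStr.{u} N.sig where
  carrier := M
  top := ⊥
  op g := N.op g
  dom h := (N.dom h : Set _)
  pop h := N.pop h
  rel r := (N.rel r : Set _)

/-- The substructure of the power `N ^ A` whose universe is the set of homomorphisms `A → M`. -/
def homSub {L : FirstOrder.Language.{v, w}} {M : Alg.{u} L} (N : AlterEgo.{u, v, w, z} M) (A : Alg.{u} L) :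
    TopStr.Sub (N.toTopStr.power A) where
  carrier := Set.range fun x : A →[L] M => (x : A → M)
  op_mem g x hx := by
    choose y hy using hx
    obtain rfl : (fun i => (y i : A → M)) = x := funext hy
    refine ⟨⟨fun a => N.op g (fun i => y i a), fun {n} f a => ?_, fun {n} r a ha => ?_⟩, rfl⟩
    · have : (fun i => y i (FirstOrder.Language.Structure.funMap f a)) =
          FirstOrder.Language.Structure.funMap f (fun j i => y i (a j)) := by
        funext i
        exact (y i).map_fun f a
      rw [this]
      exact (N.op g).map_fun f _
    · exact (N.op g).map_rel r (fun j i => y i (a j)) fun i => (y i).map_rel r a ha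
  pop_mem h x hd hx := by
    choose y hy using hx
    obtain rfl : (fun i => (y i : A → M)) = x := funext hy
    refine ⟨⟨fun a => N.pop h ⟨fun i => y i a, hd a⟩, fun {n} f a => ?_, fun {n} r a ha => ?_⟩, rfl⟩
    · have : (⟨fun i => y i (FirstOrder.Language.Structure.funMap f a), hd _⟩ : N.dom h) =
          FirstOrder.Language.Structure.funMap f (fun j => ⟨fun i => y i (a j), hd (a j)⟩) := by
        apply Subtype.ext
        funext i
        exact (y i).map_fun f a
      rw [this]
      exact (N.pop h).map_fun f _
    · exact (N.pop h).map_rel r (fun j => ⟨fun i => y i (a j), hd (a j)⟩)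
        fun i => (y i).map_rel r a ha

/-- The dual space `D(A)`: the set of homomorphisms `A → M`, as a substructure of `N ^ A`. -/
def D {L : FirstOrder.Language.{v, w}} {M : Alg.{u} L} (N : AlterEgo.{u, v, w, z} M) (A : Alg.{u} L) :
    TopStr.{u} N.sig :=
  (N.homSub A).toTopStr

/-- Pointwise application of a basic operation of `M` to morphisms `X → N` gives a morphism. -/
def funMapHom {L : FirstOrder.Language.{v, w}} {M : Alg.{u} L} (N : AlterEgo.{u, v, w, z} M)
    (X : TopStr.{u} N.sig) {n : ℕ} (f : L.Functions n) (x : Fin n → TopStr.Hom X N.toTopStr) :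
    TopStr.Hom X N.toTopStr where
  toFun p := FirstOrder.Language.Structure.funMap (M := M) f (fun i => x i p)
  continuous_toFun := by
    let _ : TopologicalSpace M.carrier := ⊥
    have : DiscreteTopology M.carrier := ⟨rfl⟩
    have h₁ : Continuous (fun y : Fin n → M => FirstOrder.Language.Structure.funMap (M := M) f y) :=
      continuous_of_discreteTopology
    have h₂ : Continuous (fun (p : X) (i : Fin n) => ((x i p : N.toTopStr) : M.carrier)) :=
      continuous_pi fun i => (x i).continuous_toFun
    exact h₁.comp h₂
  map_op g p := by
    have h : (fun i => x i (X.op g p)) = fun i => N.op g (fun j => x i (p j)) :=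
      funext fun i => (x i).map_op g p
    rw [h]
    exact ((N.op g).map_fun f (fun i j => x i (p j))).symm
  map_dom h p hp := (N.dom h).fun_mem f (fun i j => x i (p j)) fun i => (x i).map_dom h p hp
  map_pop h p hp := by
    have e : (fun i => x i (X.pop h ⟨p, hp⟩)) =
        fun i => N.pop h ⟨fun j => x i (p j), (x i).map_dom h p hp⟩ :=
      funext fun i => (x i).map_pop h p hp
    rw [e]
    exact ((N.pop h).map_fun f
      (fun i => ⟨fun j => x i (p j), (x i).map_dom h p hp⟩)).symm
  map_rel r p hp := (N.rel r).fun_mem f (fun i j => x i (p j)) fun i => (x i).map_rel r p hp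

/-- The algebra `E(X)`: the set of morphisms `X → N`, with the pointwise operations of `M`. -/
def E {L : FirstOrder.Language.{v, w}} {M : Alg.{u} L} (N : AlterEgo.{u, v, w, z} M)
    (X : TopStr.{u} N.sig) : Alg.{u} L where
  carrier := TopStr.Hom X N.toTopStr
  str :=
    { funMap := fun f x => N.funMapHom X f x
      RelMap := fun r x => ∀ p, FirstOrder.Language.Structure.RelMap (M := M) r (fun i => x i p) }

/-- The evaluation map `e_A : A → E(D(A))`, sending `a` to the map `x ↦ x a`. -/
def eval {L : FirstOrder.Language.{v, w}} {M : Alg.{u} L} (N : AlterEgo.{u, v, w, z} M) (A : Alg.{u} L)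
    (a : A) : N.E (N.D A) :=
  ({ toFun := fun x => x.1 a
     continuous_toFun := (continuous_apply a).comp continuous_subtype_val
     map_op := fun _ _ => rfl
     map_dom := fun _ _ hx => hx a
     map_pop := fun _ _ _ => rfl
     map_rel := fun _ _ hx => hx a } : TopStr.Hom (N.D A) N.toTopStr)

/-- `N` yields a duality on `ISP(M)`: every evaluation map `e_A` (which is always an embedding)
is surjective. -/
def YieldsDuality {L : FirstOrder.Language.{v, w}} {M : Alg.{u} L} (N : AlterEgo.{u, v, w, z} M) : Prop :=
  ∀ A ∈ ISP {M}, Function.Surjective (N.eval A)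

/-- `N` yields a strong duality on `ISP(M)`: it yields a duality, and `N` is injective in the
category of isomorphic copies of closed substructures of non-empty powers of `N`. -/
def YieldsStrongDuality {L : FirstOrder.Language.{v, w}} {M : Alg.{u} L} (N : AlterEgo.{u, v, w, z} M) :
    Prop :=
  N.YieldsDuality ∧
    ∀ X ∈ TopStr.IScP N.toTopStr, ∀ Y ∈ TopStr.IScP N.toTopStr,
      ∀ φ : TopStr.Hom X Y, TopStr.IsEmbedding φ →
        ∀ α : TopStr.Hom X N.toTopStr, ∃ β : TopStr.Hom Y N.toTopStr, ∀ x, β (φ x) = α x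

end AlterEgo

end NaturalDuality

/-! Membership in `ISP K` is the separation of points by homomorphisms into members of `K`
(`mem_ISP_iff`), so both inclusions reduce to separation statements about the generating algebras.

For every `D(B)`-substructure `Y` of `D(B)`, `E(Y)` lies in `ISP(B)` (`E_mem_ISP_of_isYSub`):
composition with a morphism `D(B) → Y` maps `E(Y)` to `E(D(B))`, which the duality identifies with
`B`. Since the images of such morphisms generate `Y`, two distinct elements of `E(Y)` are separated
by one of these maps.

Conversely, `B` embeds in `E(D(B))` by evaluation, and restriction maps `E(D(B))` to each `E(Y)`.
These restrictions jointly separate points (`Hom.ext_of_maximal_supIrred`): by finiteness `D(B)` is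
built by joins from join-irreducible substructures, each of which lies below a maximal one, and
morphisms that agree on generators are equal. -/

namespace NaturalDuality

open FirstOrder

/-! ### The operator `ISP` and separation of points -/

/-- A non-empty algebra lies in `ISP K` if and only if homomorphisms into members of `K` separate
its points. -/
theorem mem_ISP_iff {L : FirstOrder.Language.{v, w}} [L.IsAlgebraic] {K : Set (Alg.{u} L)}
    {A : Alg.{u} L} :
    A ∈ ISP K ↔ Nonempty A ∧ ∀ a b : A, a ≠ b → ∃ C ∈ K, ∃ f : A →[L] C, f a ≠ f b := by
  constructor
  · rintro ⟨_, ⟨_, ⟨ι, F, hF, rfl⟩, T, ⟨t, ht⟩, rfl⟩, ⟨e⟩⟩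
    refine ⟨⟨e.symm ⟨t, ht⟩⟩, fun a b hab => ?_⟩
    have h : (e a).1 ≠ (e b).1 := fun h => hab (e.injective (Subtype.ext h))
    obtain ⟨i, hi⟩ := Function.ne_iff.1 h
    refine ⟨F i, hF i, ⟨fun x => (e x).1 i, fun f x => ?_, fun r => isEmptyElim r⟩, hi⟩
    exact congrArg (fun y => y.1 i) (e.map_fun f x)
  · rintro ⟨⟨a₀⟩, h⟩
    -- One factor for each pair of distinct points, so that every pair is separated in some
    -- coordinate of the product.
    choose C hC f hf using fun p : {p : A × A // p.1 ≠ p.2} => h p.1.1 p.1.2 p.2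
    let P : Alg.{u} L := Alg.mk (∀ p, C p)
    let φ : A →[L] P :=
      ⟨fun a p => f p a, fun g x => funext fun p => (f p).map_fun g x, fun r => isEmptyElim r⟩
    have hφ : Function.Injective φ := fun a b hab => by
      by_contra hne
      exact hf ⟨(a, b), hne⟩ (congrFun hab ⟨(a, b), hne⟩)
    let ψ : A ↪[L] P := Language.Embedding.ofInjective hφ
    exact ⟨_, ⟨P, ⟨_, C, hC, rfl⟩, ψ.toHom.range, ⟨_, ⟨a₀, rfl⟩⟩, rfl⟩, ⟨ψ.equivRange⟩⟩

/-- Separation is transitive: a homomorphism into a member of `K` that separates two points is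
followed by one into a member of `K'` that separates their images. -/
theorem ISP_subset_ISP {L : FirstOrder.Language.{v, w}} [L.IsAlgebraic] {K K' : Set (Alg.{u} L)}
    (h : K ⊆ ISP K') : ISP K ⊆ ISP K' := by
  intro A hA
  rw [mem_ISP_iff] at hA ⊢
  refine ⟨hA.1, fun a b hab => ?_⟩
  obtain ⟨C, hC, f, hf⟩ := hA.2 a b hab
  obtain ⟨C', hC', g, hg⟩ := (mem_ISP_iff.1 (h hC)).2 _ _ hf
  exact ⟨C', hC', g.comp f, hg⟩

namespace TopStr

/-! ### Morphisms of topological structures -/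

/-- The composite of two morphisms. -/
def Hom.comp {τ : Sig.{z}} {X Y Z : TopStr.{u} τ} (ψ : Hom Y Z) (φ : Hom X Y) : Hom X Z where
  toFun x := ψ (φ x)
  continuous_toFun := ψ.continuous_toFun.comp φ.continuous_toFun
  map_op g x := (congrArg ψ (φ.map_op g x)).trans (ψ.map_op g _)
  map_dom h x hx := ψ.map_dom h _ (φ.map_dom h x hx)
  map_pop h x hx := (congrArg ψ (φ.map_pop h x hx)).trans (ψ.map_pop h _ _)
  map_rel r x hx := ψ.map_rel r _ (φ.map_rel r x hx)

/-- The inclusion of a substructure. -/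
def Sub.subtype {τ : Sig.{z}} {X : TopStr.{u} τ} (Y : Sub X) : Hom Y.toTopStr X where
  toFun x := x.1
  continuous_toFun := continuous_subtype_val
  map_op _ _ := rfl
  map_dom _ _ hx := hx
  map_pop _ _ _ := rfl
  map_rel _ _ hx := hx

/-- A morphism, regarded as a morphism into a substructure that contains its image. -/
def Hom.codRestrict {τ : Sig.{z}} {X Y : TopStr.{u} τ} (φ : Hom X Y) (Z : Sub Y)
    (h : ∀ x, φ x ∈ Z) : Hom X Z.toTopStr where
  toFun x := ⟨φ x, h x⟩
  continuous_toFun := Continuous.subtype_mk φ.continuous_toFun _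
  map_op g x := Subtype.ext (φ.map_op g x)
  map_dom h x hx := φ.map_dom h x hx
  map_pop h x hx := Subtype.ext (φ.map_pop h x hx)
  map_rel r x hx := φ.map_rel r x hx

/-- The substructure on which two morphisms, defined on a substructure `Y` of `X`, agree. -/
def Sub.eqLocus {τ : Sig.{z}} {X Z : TopStr.{u} τ} {Y : Sub X} (f g : Hom Y.toTopStr Z) :
    Sub X where
  carrier := {x | ∃ hx : x ∈ Y, f ⟨x, hx⟩ = g ⟨x, hx⟩}
  op_mem o x hx := by
    choose hY hfg using hx
    refine ⟨Y.op_mem o x hY, ?_⟩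
    have hf := f.map_op o fun i => ⟨x i, hY i⟩
    have hg := g.map_op o fun i => ⟨x i, hY i⟩
    have e : (f.toFun ∘ fun i => (⟨x i, hY i⟩ : Y.toTopStr)) =
        g.toFun ∘ fun i => (⟨x i, hY i⟩ : Y.toTopStr) := funext hfg
    rw [e] at hf
    exact hf.trans hg.symm
  pop_mem p x hd hx := by
    choose hY hfg using hx
    refine ⟨Y.pop_mem p x hd hY, ?_⟩
    have hf := f.map_pop p (fun i => ⟨x i, hY i⟩) hd
    have hg := g.map_pop p (fun i => ⟨x i, hY i⟩) hd
    have e : (f.toFun ∘ fun i => (⟨x i, hY i⟩ : Y.toTopStr)) =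
        g.toFun ∘ fun i => (⟨x i, hY i⟩ : Y.toTopStr) := funext hfg
    exact hf.trans ((congrArg (Z.pop p) (Subtype.ext e)).trans hg.symm)

/-- Morphisms on a substructure are determined by their values on a generating set. -/
theorem Hom.ext_of_le_closure {τ : Sig.{z}} {X Z : TopStr.{u} τ} {Y : Sub X} {s : Set X}
    (hs : s ⊆ Y) (hY : Y ≤ closure s) {f g : Hom Y.toTopStr Z}
    (h : ∀ (x : X) (hx : x ∈ s), f ⟨x, hs hx⟩ = g ⟨x, hs hx⟩) : f = g := by
  refine DFunLike.ext f g fun x => ?_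
  -- The equalizer is a substructure, so it contains whatever its subset `s` generates.
  have hle : closure s ≤ Sub.eqLocus f g := closure_le fun y hy => Exists.intro (hs hy) (h y hy)
  exact (hle (hY x.2)).2

/-! ### The lattice of `X`-substructures -/

instance instFiniteSLat {τ : Sig.{z}} (X : TopStr.{u} τ) [Finite X] : Finite (SLat X) :=
  have : Finite (Sub X) := Finite.of_injective _ (SetLike.coe_injective (A := Sub X))
  inferInstanceAs (Finite {Z : Sub X // IsYSub X Z})

/-- The whole structure, as an `X`-substructure of `X`. -/
def SLat.whole {τ : Sig.{z}} (X : TopStr.{u} τ) : SLat X where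
  val := ⟨Set.univ, fun _ _ _ => trivial, fun _ _ _ _ => trivial⟩
  property := by
    let φ : Hom X X := ⟨id, continuous_id, fun _ _ => rfl, fun _ _ hx => hx, fun _ _ _ => rfl,
      fun _ _ hx => hx⟩
    refine ⟨1, fun _ => φ, le_antisymm (fun x _ => ?_) fun _ _ => trivial⟩
    exact subset_closure _ (Set.mem_iUnion.2 ⟨0, x, rfl⟩)

/-- The least `X`-substructure of `X`. -/
def SLat.least {τ : Sig.{z}} (X : TopStr.{u} τ) : SLat X :=
  ⟨closure ∅, 0, Fin.elim0, by rw [Set.iUnion_of_empty]⟩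

/-- For finite `X`, morphisms on `X` are determined by their restrictions to the maximal
join-irreducible `X`-substructures. -/
theorem Hom.ext_of_maximal_supIrred {τ : Sig.{z}} {X Z : TopStr.{u} τ} [Finite X]
    {f g : Hom X Z}
    (h : ∀ Y : SLat X, Maximal SupIrred Y → ∀ x ∈ Y.1, f x = g x) : f = g := by
  -- Generalising from the whole structure to all of its `X`-substructures makes induction along
  -- strict inclusion possible.
  suffices H : ∀ Y : SLat X, f.comp Y.1.subtype = g.comp Y.1.subtype from
    DFunLike.ext _ _ fun x => DFunLike.congr_fun (H (SLat.whole X)) ⟨x, trivial⟩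
  intro Y
  induction Y using WellFoundedLT.induction with
  | ind Y ih =>
  by_cases hY : SupIrred Y
  · obtain ⟨W, hYW, hW⟩ := (Set.toFinite {W : SLat X | SupIrred W}).exists_le_maximal hY
    exact DFunLike.ext _ _ fun x => h W hW x.1 (hYW x.2)
  rcases not_supIrred.1 hY with hmin | ⟨V, W, rfl, hV, hW⟩
  -- A minimal `Y` is generated by the empty set, so there are no generators to check.
  · exact Hom.ext_of_le_closure (Set.empty_subset _)
      (hmin (show SLat.least X ≤ Y from closure_le (Set.empty_subset _))) fun _ hx => hx.elim
  · refine Hom.ext_of_le_closure (s := (V.1 : Set X) ∪ W.1) (subset_closure _) le_rfl ?_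
    rintro x (hx | hx)
    · exact DFunLike.congr_fun (ih V hV) ⟨x, hx⟩
    · exact DFunLike.congr_fun (ih W hW) ⟨x, hx⟩

end TopStr

namespace AlterEgo

variable {L : FirstOrder.Language.{v, w}} {M : Alg.{u} L} (N : AlterEgo.{u, v, w, z} M)

/-! ### The dual functors -/

instance instFiniteD [Finite M] (A : Alg.{u} L) [Finite A] : Finite (N.D A) :=
  inferInstanceAs (Finite {x : A → M // x ∈ N.homSub A})

/-- The homomorphism `E(Y) → E(X)`, composition with a morphism `X → Y`. -/
def mapE {X Y : TopStr.{u} N.sig} (φ : TopStr.Hom X Y) : N.E Y →[L] N.E X where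
  toFun f := TopStr.Hom.comp f φ
  map_fun' _ _ := rfl
  map_rel' _ _ h p := h (φ p)

/-- The evaluation map is a homomorphism. -/
def evalHom [L.IsAlgebraic] (A : Alg.{u} L) : A →[L] N.E (N.D A) where
  toFun := N.eval A
  map_fun' f a := TopStr.Hom.ext <| funext fun x => by
    obtain ⟨_, y, rfl⟩ := x
    exact y.map_fun f a
  map_rel' r := isEmptyElim r

/-- The homomorphisms `A → M` that separate points of `A` are themselves the points of `D(A)`. -/
theorem eval_injective [L.IsAlgebraic] {A : Alg.{u} L} (hA : A ∈ ISP {M}) :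
    Function.Injective (N.eval A) := by
  intro a b hab
  by_contra hne
  obtain ⟨_, rfl, f, hf⟩ := (mem_ISP_iff.1 hA).2 a b hne
  exact hf (congrArg (fun e : TopStr.Hom (N.D A) N.toTopStr => e.toFun ⟨fun x => f x, f, rfl⟩) hab)

/-- The inverse of the evaluation map, under a duality. -/
theorem exists_injective_hom_of_yieldsDuality [L.IsAlgebraic] (hN : N.YieldsDuality)
    {A : Alg.{u} L} (hA : A ∈ ISP {M}) :
    ∃ e : N.E (N.D A) →[L] A, Function.Injective e :=
  let ψ := Language.Embedding.ofInjective (f := N.evalHom A) (N.eval_injective hA)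
  let e : A ≃[L] N.E (N.D A) :=
    ⟨Equiv.ofBijective ψ ⟨ψ.injective, hN A hA⟩, fun f x => ψ.map_fun f x, fun r => isEmptyElim r⟩
  ⟨e.symm.toHom, e.symm.injective⟩

/-- If `Y` is generated by images of morphisms from `D(A)`, then `E(Y)` lies in `ISP(A)`. -/
theorem E_mem_ISP_of_isYSub [L.IsAlgebraic] (hN : N.YieldsDuality) {A : Alg.{u} L}
    (hA : A ∈ ISP {M}) {Y : TopStr.Sub (N.D A)} (hY : TopStr.IsYSub (N.D A) Y) :
    N.E Y.toTopStr ∈ ISP {A} := by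
  obtain ⟨e, he⟩ := N.exists_injective_hom_of_yieldsDuality hN hA
  obtain ⟨a⟩ := (mem_ISP_iff.1 hA).1
  refine mem_ISP_iff.2 ⟨⟨N.mapE Y.subtype (N.eval A a)⟩, fun f g hfg => ?_⟩
  obtain ⟨m, φ, rfl⟩ := hY
  by_contra! h
  refine hfg (TopStr.Hom.ext_of_le_closure (TopStr.subset_closure _) le_rfl fun x hx => ?_)
  obtain ⟨i, x, rfl⟩ := Set.mem_iUnion.1 hx
  -- As `e` is injective, failure of `e ∘ E(ψ)` to separate `f` and `g` forces them to agree on the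
  -- image of `φ i`.
  let ψ := (φ i).codRestrict (TopStr.closure (⋃ i, Set.range (φ i)))
    fun x => TopStr.subset_closure _ (Set.mem_iUnion.2 ⟨i, x, rfl⟩)
  exact DFunLike.congr_fun (F := TopStr.Hom (N.D A) N.toTopStr)
    (he (h A rfl (e.comp (N.mapE ψ)))) x

/-- A finite algebra `A` lies in the class generated by the duals of the maximal join-irreducible
`D(A)`-substructures of `D(A)`. -/
theorem mem_ISP_maximal_supIrred [L.IsAlgebraic] [Finite M] {A : Alg.{u} L} [Finite A]
    (hA : A ∈ ISP {M}) :
    A ∈ ISP {C : Alg.{u} L | ∃ Y : TopStr.SLat (N.D A),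
      Maximal SupIrred Y ∧ C = N.E Y.1.toTopStr} := by
  refine mem_ISP_iff.2 ⟨(mem_ISP_iff.1 hA).1, fun a b hab => ?_⟩
  by_contra! h
  refine hab (N.eval_injective hA (TopStr.Hom.ext_of_maximal_supIrred fun Y hY x hx => ?_))
  -- The homomorphism tested against `a` and `b` is evaluation followed by restriction to `Y`.
  exact DFunLike.congr_fun (F := TopStr.Hom Y.1.toTopStr N.toTopStr)
    (h _ ⟨Y, hY, rfl⟩ ((N.mapE Y.1.subtype).comp (N.evalHom A))) ⟨x, hx⟩

end AlterEgo

end NaturalDuality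

theorem corollary5p5 {L : FirstOrder.Language.{v, w}} [L.IsAlgebraic] (M : NaturalDuality.Alg.{u} L) [Finite M] [Nonempty M]
    (N : NaturalDuality.AlterEgo.{u, v, w, z} M) (hN : N.YieldsStrongDuality)
    (B : NaturalDuality.Alg.{u} L) [Finite B] (hB : B ∈ NaturalDuality.ISP {M}) :
    NaturalDuality.ISP {B} = NaturalDuality.ISP {A : NaturalDuality.Alg.{u} L | ∃ Y : NaturalDuality.TopStr.SLat (N.D B),
      Maximal SupIrred Y ∧ A = N.E Y.1.toTopStr} := by
  refine subset_antisymm (NaturalDuality.ISP_subset_ISP ?_) (NaturalDuality.ISP_subset_ISP ?_)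
  · rintro _ rfl
    exact N.mem_ISP_maximal_supIrred hB
  · rintro _ ⟨Y, -, rfl⟩
    exact N.E_mem_ISP_of_isYSub hN.1 hB Y.2
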